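/- Let $N\ge 0$ and let $L\in\mathbb R^{N\times N}$ be a symmetric positive semidefinite matrix (in particular, $L$ may be positive definite). Write $\langle u,v\rangle=v^Tu$ and $\|u\|=\sqrt{\langle u,u\rangle}$ on $\mathbb R^N$. Let $G,g:\mathbb R^N\to\mathbb R^N$ be such that $g$ is the negative gradient of the function $v\mapsto\langle G(v),1\rangle=\sum_i G(v)_i$, and suppose that $g$ is Lipschitz continuous with a constant $\ell_g>0$, i.e. $\|g(u)-g(v)\|\le \ell_g\|u-v\|$ for all $u,v$. Define the energy $$E[u]=\tfrac12\langle u,Lu\rangle+\langle G(u),1\rangle ,$$ let $\kappa\ge 2\ell_g$, and put $L_\kappa=L+\kappa I$ and $g_\kappa(u)=\kappa u+g(u)$. Given a lower triangular $3\times3$ matrix function $\widehat A(z)=[\hat a_{i+1,j}(z)]_{i,j=1}^3$, step sizes $\tau_n>0$ $(n\ge1)$ and an initial vector $u^0\in\mathbb R^N$, the associated scheme computes $u^n$ from $u^{n-1}$, for $n\ge1$ and with $\tau=\tau_n$, by $U^{n,1}=u^{n-1}$, $$U^{n,i+1}=U^{n,1}+\sum_{j=1}^{i}\hat a_{i+1,j}(-\tau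 L_\kappa)\bigl[\tau g_\kappa(U^{n,j})-\tau L_\kappa U^{n,1}\bigr]\quad(1\le i\le3),\qquad u^n=U^{n,4},$$ where functions of the symmetric matrix $-\tau L_\kappa$ are defined on its spectrum (which lies in $z<0$). The TIF3-Heun and NIF3-Heun schemes are those with, respectively, $$\widehat A_{\mathrm T}(z)=\begin{pmatrix}\frac1{3-z}&0&0\\[2pt]0&\frac{2}{3e^{z/3}-2z}&0\\[2pt]\frac{e^{2z/3}}{e^{2z/3}(4-z)-3z}&0&\frac{3}{e^{2z/3}(4-z)-3z}\end{pmatrix},\qquad \widehat A_{\mathrm N}(z)=\begin{pmatrix}\frac{e^{z/3}-1}{z}&0&0\\[2pt]0&\frac{e^{2z/3}-1}{z}&0\\[2pt]\frac{e^{z}}4&0&\frac{e^z-1}{z}-\frac{e^z}4\end{pmatrix}.$$ Let $D(z)=\widehat A(z)^{-1}E_3+zE_3-\frac z2 I$, where $E_3$ is the lower triangular $3\times 3$ matrix full of ones, let $D_j(z)$ be the leading $j\times j$ block of $D(z)$, and let $\delta\vec U_{n,j+1}=(U^{n,2}-U^{n,1},\dots,U^{n,j+1}-U^{n,j})^T$.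 Then both the TIF3-Heun and the NIF3-Heun scheme preserve the original energy dissipation law at all stages: for all step sizes $\tau_n>0$ and all initial vectors $u^0$, $$E[U^{n,j+1}]-E[U^{n,1}]\le-\frac1{\tau_n}\bigl\langle\delta\vec U_{n,j+1},\,D_j(-\tau_nL_\kappa)\,\delta\vec U_{n,j+1}\bigr\rangle\le0\qquad(1\le j\le3,\ n\ge1),$$ with $D$ formed from the $\widehat A$ of the scheme in question; in particular $E[u^n]\le E[u^{n-1}]$ for all $n\ge1$. -/

import Mathlib

noncomputable section

namespace GradientFlow

/-- Grid functions on a finite mesh `ι`; the discrete inner product is `⟨u, v⟩ = vᵀ u`. -/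
abbrev Grid (ι : Type*) [Fintype ι] := EuclideanSpace ℝ ι

variable {ι : Type*} [Fintype ι] [DecidableEq ι]

/-- The discrete energy `E[u] = ½ ⟨u, L u⟩ + ⟨G(u), 1⟩`. -/
def energy (L : Matrix ι ι ℝ) (G : Grid ι → Grid ι) (u : Grid ι) : ℝ :=
  (1 / 2) * inner ℝ u (L.toEuclideanLin u) + ∑ i, G u i

/-- The stabilized linear part `L_κ = L + κ I`. -/
def stabMatrix (L : Matrix ι ι ℝ) (κ : ℝ) : Matrix ι ι ℝ := L + κ • (1 : Matrix ι ι ℝ)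

/-- The stabilized nonlinear part `g_κ(u) = κ u + g(u)`. -/
def stabNonlin (g : Grid ι → Grid ι) (κ : ℝ) (u : Grid ι) : Grid ι := κ • u + g u

/-- `f(-τ L_κ)`: the matrix function given by the values of `f` on the spectrum
of the symmetric matrix `-τ L_κ`. -/
def matFun (f : ℝ → ℝ) (L : Matrix ι ι ℝ) (κ τ : ℝ) : Matrix ι ι ℝ :=
  cfc f (-(τ • stabMatrix L κ))

/-- One step of size `τ` of the `s`-stage steady-state preserving explicit exponential
Runge-Kutta method with (lower triangular) coefficient matrix `A(z)`:
`U_{i+1} = U_1 + ∑_{j ≤ i} A_{ij}(-τ L_κ) [τ g_κ(U_j) - τ L_κ U_1]` for `1 ≤ i ≤ s`.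
The stages `U_1, …, U_{s+1}` are `U 0, …, U (Fin.last s)`. -/
def IsStep {s : ℕ} (A : ℝ → Matrix (Fin s) (Fin s) ℝ) (L : Matrix ι ι ℝ)
    (g : Grid ι → Grid ι) (κ τ : ℝ) (U : Fin (s + 1) → Grid ι) : Prop :=
  ∀ i : Fin s, U i.succ = U 0 + ∑ j ∈ Finset.Iic i,
    (matFun (fun z => A z i j) L κ τ).toEuclideanLin
      (τ • stabNonlin g κ (U j.castSucc) - τ • (stabMatrix L κ).toEuclideanLin (U 0))

/-- The full time-marching scheme with step sizes `τ n`: the `n`-th step starts from `u n`, has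
the stages `U n`, and ends in `u (n + 1)`. -/
def IsNumericalSolution {s : ℕ} (A : ℝ → Matrix (Fin s) (Fin s) ℝ) (L : Matrix ι ι ℝ)
    (g : Grid ι → Grid ι) (κ : ℝ) (τ : ℕ → ℝ) (u : ℕ → Grid ι)
    (U : ℕ → Fin (s + 1) → Grid ι) : Prop :=
  ∀ n, U n 0 = u n ∧ IsStep A L g κ (τ n) (U n) ∧ u (n + 1) = U n (Fin.last s)

/-- The lower triangular matrix full of ones. -/
def lowerOnes (s : ℕ) : Matrix (Fin s) (Fin s) ℝ :=
  Matrix.of fun i j => if j ≤ i then 1 else 0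

/-- The differentiation matrix `D(z) = A(z)⁻¹ E_s + z E_s - (z/2) I`. -/
def diffMatrix {s : ℕ} (A : ℝ → Matrix (Fin s) (Fin s) ℝ) (z : ℝ) : Matrix (Fin s) (Fin s) ℝ :=
  (A z)⁻¹ * lowerOnes s + z • lowerOnes s - (z / 2) • (1 : Matrix (Fin s) (Fin s) ℝ)

/-- The quadratic form `⟨δU_{j+1}, D_j(-τ L_κ) δU_{j+1}⟩`, where `D_j` is the leading `j × j` block
of the differentiation matrix `D` and `δU_{j+1} = (U_2 - U_1, …, U_{j+1} - U_j)`. -/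
def dissipationForm {s : ℕ} (A : ℝ → Matrix (Fin s) (Fin s) ℝ) (L : Matrix ι ι ℝ) (κ τ : ℝ)
    (U : Fin (s + 1) → Grid ι) (j : Fin s) : ℝ :=
  ∑ k ∈ Finset.Iic j, ∑ l ∈ Finset.Iic j,
    inner ℝ (U k.succ - U k.castSucc)
      ((matFun (fun z => diffMatrix A z k l) L κ τ).toEuclideanLin (U l.succ - U l.castSucc))

/-- The scheme with coefficient matrix `A(z)` preserves the original energy dissipation law at all
stages: for all positive step sizes and all initial data,
`E[U_{j+1}] - E[U_1] ≤ -(1/τ) ⟨δU_{j+1}, D_j(-τ L_κ) δU_{j+1}⟩ ≤ 0` at every stage of every step;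
in particular `E[u_{n+1}] ≤ E[u_n]`. -/
def PreservesEnergyLawAtAllStages {s : ℕ} (A : ℝ → Matrix (Fin s) (Fin s) ℝ) (L : Matrix ι ι ℝ)
    (G g : Grid ι → Grid ι) (κ : ℝ) : Prop :=
  ∀ (τ : ℕ → ℝ) (u : ℕ → Grid ι) (U : ℕ → Fin (s + 1) → Grid ι), (∀ n, 0 < τ n) →
    IsNumericalSolution A L g κ τ u U → ∀ n,
      (∀ j : Fin s,
        energy L G (U n j.succ) - energy L G (U n 0)
            ≤ -(1 / τ n) * dissipationForm A L κ (τ n) (U n) j ∧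
        -(1 / τ n) * dissipationForm A L κ (τ n) (U n) j ≤ 0) ∧
      energy L G (u (n + 1)) ≤ energy L G (u n)

open Real in
/-- Coefficient matrix of the telescopic corrected third-order Heun scheme (TIF3-Heun). -/
def heunTIF3 (z : ℝ) : Matrix (Fin 3) (Fin 3) ℝ :=
  !![1 / (3 - z), 0, 0;
     0, 2 / (3 * exp (z / 3) - 2 * z), 0;
     exp (2 * z / 3) / (exp (2 * z / 3) * (4 - z) - 3 * z), 0,
       3 / (exp (2 * z / 3) * (4 - z) - 3 * z)]

open Real in
/-- Coefficient matrix of the nonlinear-term translation corrected third-order Heun scheme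
(NIF3-Heun). It is only evaluated at `z < 0`, on the spectrum of `-τ L_κ`. -/
def heunNIF3 (z : ℝ) : Matrix (Fin 3) (Fin 3) ℝ :=
  !![(exp (z / 3) - 1) / z, 0, 0;
     0, (exp (2 * z / 3) - 1) / z, 0;
     exp z / 4, 0, (exp z - 1) / z - exp z / 4]

end GradientFlow

end

noncomputable section

namespace GradientFlow

open Finset Matrix

/-! ### Simultaneous diagonalization of the functions of `-τ L_κ`. -/

section Spectral

variable {ι : Type*} [Fintype ι] [DecidableEq ι]

/-! In an eigenbasis of `-τ L_κ` each step is a scalar recursion with a parameter `z < 0`. Stage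
increments δ and forcing terms F satisfy E δ = A(z) F, so A⁻¹E δ recovers F, and the terms zE -
(z/2)I turn it into the Crank-Nicolson-like identity (D δ)_k = τ [g_κ(U_k) - ½ L_κ(U_{k+1} + U_k)]
(`sum_matFun_diffMatrix`). Paired with U_{k+1} - U_k, the bracket bounds the energy drop between
consecutive stages from below, since κ ≥ 2ℓ absorbs the error of linearizing the potential
(`energy_sub_le`). Telescoping gives the first inequality.

The second reduces to D(z) having a nonnegative quadratic form for every z < 0. For both Heun
schemes the entries below the diagonal are nonnegative and weakly dominated by the diagonal
(`quadForm_nonneg_of_dominant`), which comes down to elementary estimates in x = e^{z/3} ∈ (0, 1).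
-/

lemma toEuclideanLin_stabMatrix (L : Matrix ι ι ℝ) (κ : ℝ) (v : Grid ι) :
    (stabMatrix L κ).toEuclideanLin v = L.toEuclideanLin v + κ • v := by
  ext i
  simp [stabMatrix]

lemma isHermitian_neg_smul_stabMatrix {ι : Type*} [DecidableEq ι] {L : Matrix ι ι ℝ} (hL : L.IsHermitian) (κ τ : ℝ) :
    (-(τ • stabMatrix L κ)).IsHermitian := by
  have h : (stabMatrix L κ).IsHermitian :=
    hL.add (Matrix.isHermitian_one.smul (IsSelfAdjoint.all κ))
  exact (h.smul (IsSelfAdjoint.all τ)).neg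

/-- No continuity of `f` is needed because the spectrum is finite. -/
lemma _root_.Matrix.IsHermitian.toEuclideanLin_cfc_eigenvectorBasis {M : Matrix ι ι ℝ}
    (hM : M.IsHermitian) (f : ℝ → ℝ) (m : ι) :
    (cfc f M).toEuclideanLin (hM.eigenvectorBasis m) =
      f (hM.eigenvalues m) • hM.eigenvectorBasis m := by
  have h : cfc f M *ᵥ (hM.eigenvectorBasis m).ofLp =
      f (hM.eigenvalues m) • (hM.eigenvectorBasis m).ofLp := by
    rw [hM.cfc_eq, IsHermitian.cfc, Unitary.conjStarAlgAut_apply, ← mulVec_mulVec,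
      hM.star_eigenvectorUnitary_mulVec, ← mulVec_mulVec, diagonal_mulVec_single]
    have := hM.eigenvectorUnitary_mulVec m
    rw [show (Pi.single m ((RCLike.ofReal ∘ f ∘ hM.eigenvalues) m * 1) : ι → ℝ) =
      f (hM.eigenvalues m) • Pi.single m 1 by ext; simp [Pi.single_apply], mulVec_smul, this]
  ext i
  simpa using congrFun h i

lemma _root_.Matrix.IsHermitian.inner_eigenvectorBasis_cfc {M : Matrix ι ι ℝ}
    (hM : M.IsHermitian) (f : ℝ → ℝ) (m : ι) (v : Grid ι) :
    inner ℝ (hM.eigenvectorBasis m) ((cfc f M).toEuclideanLin v) =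
      f (hM.eigenvalues m) * inner ℝ (hM.eigenvectorBasis m) v := by
  have h : (cfc f M).IsHermitian := (cfc_predicate f M : IsSelfAdjoint _)
  rw [← (isSymmetric_toEuclideanLin_iff.2 h) _ v, hM.toEuclideanLin_cfc_eigenvectorBasis,
    real_inner_smul_left]

lemma inner_toEuclideanLin_self_nonneg {L : Matrix ι ι ℝ} (hL : L.PosSemidef) (v : Grid ι) :
    0 ≤ inner ℝ v (L.toEuclideanLin v) := by
  have := (isPositive_toEuclideanLin_iff.2 hL).2 v
  rw [real_inner_comm]
  simpa using this

/-- The functions of `-τ L_κ` are simultaneously diagonalized by an orthonormal basis, with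
negative eigenvalues. -/
lemma exists_orthonormalBasis_matFun {L : Matrix ι ι ℝ} (hL : L.PosSemidef) {κ τ : ℝ}
    (hκ : 0 < κ) (hτ : 0 < τ) :
    ∃ (b : OrthonormalBasis ι ℝ (Grid ι)) (z : ι → ℝ), (∀ m, z m < 0) ∧
      (∀ f m v, inner ℝ (b m) ((matFun f L κ τ).toEuclideanLin v) = f (z m) * inner ℝ (b m) v) ∧
      ∀ m v, inner ℝ (b m) (τ • (stabMatrix L κ).toEuclideanLin v) = -z m * inner ℝ (b m) v := by
  have hM := isHermitian_neg_smul_stabMatrix hL.isHermitian κ τ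
  have key : ∀ m v, inner ℝ (hM.eigenvectorBasis m) (τ • (stabMatrix L κ).toEuclideanLin v) =
      -hM.eigenvalues m * inner ℝ (hM.eigenvectorBasis m) v := by
    intro m v
    have h := hM.inner_eigenvectorBasis_cfc id m v
    have hid := cfc_id ℝ (-(τ • stabMatrix L κ)) hM
    rw [show cfc id (-(τ • stabMatrix L κ)) = -(τ • stabMatrix L κ) from hid] at h
    simp only [map_neg, map_smul, LinearMap.neg_apply, LinearMap.smul_apply, inner_neg_right,
      id] at h
    linarith
  refine ⟨hM.eigenvectorBasis, hM.eigenvalues, fun m => ?_, hM.inner_eigenvectorBasis_cfc, key⟩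
  have h := key m (hM.eigenvectorBasis m)
  have h1 := inner_toEuclideanLin_self_nonneg hL (hM.eigenvectorBasis m)
  rw [toEuclideanLin_stabMatrix, real_inner_smul_right, inner_add_right, real_inner_smul_right,
    real_inner_self_eq_norm_sq, OrthonormalBasis.norm_eq_one] at h
  nlinarith [mul_nonneg hτ.le h1, mul_pos hτ hκ]

end Spectral

/-! ### Linearization error of the potential. -/

section Descent

/-- A function whose gradient is Lipschitz deviates from its linearization by at most a quadratic
term. -/
lemma le_of_hasGradientAt_lipschitz {E : Type*} [NormedAddCommGroup E] [InnerProductSpace ℝ E]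
    [CompleteSpace E] {φ : E → ℝ} {g : E → E} (hφ : ∀ v, HasGradientAt φ (-(g v)) v)
    {ℓ : NNReal} (hg : LipschitzWith ℓ g) (u v : E) :
    φ v - φ u ≤ -inner ℝ (v - u) (g u) + ℓ * ‖v - u‖ ^ 2 := by
  -- The mean value inequality gives the constant ℓ instead of the sharp ℓ/2; this is what κ ≥ 2ℓ
  -- can absorb.
  have h := (convex_segment u v).norm_image_sub_le_of_norm_hasFDerivWithin_le'
    (f' := fun x => InnerProductSpace.toDual ℝ E (-(g x)))
    (φ := InnerProductSpace.toDual ℝ E (-(g u))) (C := ℓ * ‖v - u‖)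
    (fun x _ => (hφ x).hasFDerivAt.hasFDerivWithinAt) (fun x hx => by
      rw [← map_sub, LinearIsometryEquiv.norm_map, neg_sub_neg, norm_sub_rev]
      refine (hg.norm_sub_le x u).trans ?_
      gcongr
      exact (norm_sub_le_of_mem_segment hx).trans_eq rfl)
    (left_mem_segment ℝ u v) (right_mem_segment ℝ u v)
  have h2 := (le_abs_self _).trans h
  rw [InnerProductSpace.toDual_apply_apply, inner_neg_left, real_inner_comm] at h2
  nlinarith

end Descent

/-! ### Algebra of the differentiation matrix at a fixed `z`. -/

section Triangular

variable {s : ℕ}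

lemma lowerOnes_mulVec_sub (x : Fin (s + 1) → ℝ) (i : Fin s) :
    (lowerOnes s *ᵥ fun l => x l.succ - x l.castSucc) i = x i.succ - x 0 := by
  rw [← Fin.sum_Iic_sub i x]
  simp [lowerOnes, mulVec, dotProduct, ← Finset.sum_filter, Finset.filter_ge_eq_Iic]

/-- Inverses and products of lower triangular matrices are lower triangular. Hence row k of a
leading block containing it already carries the whole row of `D`. -/
lemma diffMatrix_apply_eq_zero {A : ℝ → Matrix (Fin s) (Fin s) ℝ} {z : ℝ}
    (hlow : ∀ i j, i < j → A z i j = 0) (hdet : IsUnit (A z).det) {i j : Fin s} (hij : i < j) :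
    diffMatrix A z i j = 0 := by
  have hA : (A z).BlockTriangular OrderDual.toDual := fun i j h => hlow i j h
  have hE : (lowerOnes s).BlockTriangular OrderDual.toDual := fun i j h => by
    have : i < j := h
    simp [lowerOnes, this.not_ge]
  have := (A z).invertibleOfIsUnitDet hdet
  have h := (blockTriangular_inv_of_blockTriangular hA).mul hE
  have h1 : ((A z)⁻¹ * lowerOnes s) i j = 0 := h hij
  simp [diffMatrix, h1, hE hij, hij.ne]

/-- The differentiation matrix recovers the forcing terms from the stage increments. -/
lemma diffMatrix_mulVec {A : ℝ → Matrix (Fin s) (Fin s) ℝ} {z : ℝ}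
    (hlow : ∀ i j, i < j → A z i j = 0) (hdet : IsUnit (A z).det)
    {x : Fin (s + 1) → ℝ} {F : Fin s → ℝ}
    (hx : ∀ i, x i.succ = x 0 + ∑ j ∈ Iic i, A z i j * F j) (k : Fin s) :
    ∑ l, diffMatrix A z k l * (x l.succ - x l.castSucc) =
      F k + z * (x k.succ - x 0) - z / 2 * (x k.succ - x k.castSucc) := by
  have h1 : lowerOnes s *ᵥ (fun l => x l.succ - x l.castSucc) = A z *ᵥ F := by
    ext i
    rw [lowerOnes_mulVec_sub, hx i, add_sub_cancel_left]
    refine Finset.sum_subset (Finset.subset_univ _) fun j _ hj => ?_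
    rw [hlow i j (by simpa using hj), zero_mul]
  change (diffMatrix A z *ᵥ fun l => x l.succ - x l.castSucc) k = _
  rw [diffMatrix, sub_mulVec, add_mulVec, ← mulVec_mulVec, smul_mulVec, smul_mulVec, one_mulVec,
    h1, mulVec_mulVec, nonsing_inv_mul _ hdet, one_mulVec, ← h1]
  simp [lowerOnes_mulVec_sub]

end Triangular

/-! ### Energy law from nonnegativity of the differentiation matrix. -/

section EnergyLaw

variable {ι : Type*} [Fintype ι] [DecidableEq ι] {s : ℕ}

lemma sum_matFun_diffMatrix {A : ℝ → Matrix (Fin s) (Fin s) ℝ}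
    (hlow : ∀ z < 0, ∀ i j, i < j → A z i j = 0) (hdet : ∀ z < 0, IsUnit (A z).det)
    {L : Matrix ι ι ℝ} (hL : L.PosSemidef) {g : Grid ι → Grid ι} {κ τ : ℝ}
    (hκ : 0 < κ) (hτ : 0 < τ) {U : Fin (s + 1) → Grid ι} (hU : IsStep A L g κ τ U)
    {j k : Fin s} (hk : k ≤ j) :
    ∑ l ∈ Iic j, (matFun (fun z => diffMatrix A z k l) L κ τ).toEuclideanLin
        (U l.succ - U l.castSucc) =
      τ • (stabNonlin g κ (U k.castSucc) -
        (1 / 2 : ℝ) • (stabMatrix L κ).toEuclideanLin (U k.succ + U k.castSucc)) := by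
  obtain ⟨b, z, hz, hf, hS⟩ := exists_orthonormalBasis_matFun hL hκ hτ
  refine b.repr.injective (PiLp.ext fun m => ?_)
  rw [b.repr_apply_apply, b.repr_apply_apply]
  have key := diffMatrix_mulVec (hlow _ (hz m)) (hdet _ (hz m))
    (x := fun i => inner ℝ (b m) (U i))
    (F := fun i => τ * inner ℝ (b m) (stabNonlin g κ (U i.castSucc)) +
      z m * inner ℝ (b m) (U 0)) (fun i => by
        conv_lhs => rw [hU i, inner_add_right, inner_sum]
        congr 1
        refine Finset.sum_congr rfl fun l _ => ?_
        rw [hf, inner_sub_right, hS, real_inner_smul_right]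
        ring) k
  have hsum : ∑ l ∈ Iic j, diffMatrix A (z m) k l *
        (inner ℝ (b m) (U l.succ) - inner ℝ (b m) (U l.castSucc)) =
      ∑ l, diffMatrix A (z m) k l *
        (inner ℝ (b m) (U l.succ) - inner ℝ (b m) (U l.castSucc)) := by
    refine Finset.sum_subset (Finset.subset_univ _) fun l _ hl => ?_
    rw [diffMatrix_apply_eq_zero (hlow _ (hz m)) (hdet _ (hz m))
      (hk.trans_lt (by simpa using hl)), zero_mul]
  rw [inner_sum]
  simp only [hf, inner_sub_right]
  rw [hsum, key, smul_sub, smul_comm τ, inner_sub_right, real_inner_smul_right,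
    real_inner_smul_right (r := 1 / 2), hS, inner_add_right]
  ring

/-- Parseval splits the form into one scalar quadratic form per eigenvalue. -/
lemma dissipationForm_nonneg {A : ℝ → Matrix (Fin s) (Fin s) ℝ}
    (hpos : ∀ z < 0, ∀ y : Fin s → ℝ, 0 ≤ ∑ k, ∑ l, y k * (diffMatrix A z k l * y l))
    {L : Matrix ι ι ℝ} (hL : L.PosSemidef) {κ τ : ℝ}
    (hκ : 0 < κ) (hτ : 0 < τ) (U : Fin (s + 1) → Grid ι) (j : Fin s) :
    0 ≤ dissipationForm A L κ τ U j := by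
  obtain ⟨b, z, hz, hf, -⟩ := exists_orthonormalBasis_matFun hL hκ hτ
  have h : dissipationForm A L κ τ U j = ∑ m, ∑ k ∈ Iic j, ∑ l ∈ Iic j,
      inner ℝ (b m) (U k.succ - U k.castSucc) *
        (diffMatrix A (z m) k l * inner ℝ (b m) (U l.succ - U l.castSucc)) := by
    rw [Finset.sum_comm, dissipationForm]
    refine Finset.sum_congr rfl fun k _ => ?_
    rw [Finset.sum_comm]
    refine Finset.sum_congr rfl fun l _ => ?_
    rw [← b.sum_inner_mul_inner]
    refine Finset.sum_congr rfl fun m _ => ?_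
    rw [hf, real_inner_comm]
  rw [h]
  refine Finset.sum_nonneg fun m _ => ?_
  -- Extending the increments by zero beyond stage j reduces the leading block to the full matrix.
  refine (hpos (z m) (hz m)
    (fun k => if k ∈ Iic j then inner ℝ (b m) (U k.succ - U k.castSucc) else 0)).trans_eq ?_
  refine (Finset.sum_subset (Finset.subset_univ (Iic j)) fun k _ hk => ?_).symm.trans
    (Finset.sum_congr rfl fun k hk => (Finset.sum_subset (Finset.subset_univ (Iic j))
      fun l _ hl => ?_).symm.trans (Finset.sum_congr rfl fun l hl => ?_))
  · simp only [if_neg hk, zero_mul, Finset.sum_const_zero]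
  · rw [if_neg hl, mul_zero, mul_zero]
  · rw [if_pos hk, if_pos hl]

lemma inner_add_sub_toEuclideanLin {M : Matrix ι ι ℝ} (hM : M.IsHermitian) (u v : Grid ι) :
    inner ℝ (v - u) (M.toEuclideanLin (v + u)) =
      inner ℝ v (M.toEuclideanLin v) - inner ℝ u (M.toEuclideanLin u) := by
  have h : inner ℝ v (M.toEuclideanLin u) = inner ℝ u (M.toEuclideanLin v) := by
    rw [← (isSymmetric_toEuclideanLin_iff.2 hM) v u, real_inner_comm]
  rw [map_add, inner_add_right, inner_sub_left, inner_sub_left, h]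
  ring

/-- The energy change between two consecutive stages. -/
lemma energy_sub_le {L : Matrix ι ι ℝ} (hL : L.IsHermitian) {G g : Grid ι → Grid ι}
    (hG : ∀ v, HasGradientAt (fun w => ∑ i, G w i) (-(g v)) v)
    {ℓ : NNReal} (hg : LipschitzWith ℓ g) {κ : ℝ} (hκ : 2 * (ℓ : ℝ) ≤ κ) (u v : Grid ι) :
    energy L G v - energy L G u ≤ -inner ℝ (v - u) (stabNonlin g κ u -
      (1 / 2 : ℝ) • (stabMatrix L κ).toEuclideanLin (v + u)) := by
  have h1 := le_of_hasGradientAt_lipschitz hG hg u v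
  have h2 := inner_add_sub_toEuclideanLin hL u v
  -- The two κ-terms do not cancel: they leave the damping -(κ/2)‖v - u‖², which dominates the error
  -- ℓ‖v - u‖².
  have h3 : inner ℝ (v - u) (κ • u) - (1 / 2) * (κ * inner ℝ (v - u) (v + u)) =
      -(κ / 2) * ‖v - u‖ ^ 2 := by
    rw [← real_inner_self_eq_norm_sq, real_inner_smul_right]
    simp only [inner_sub_left, inner_sub_right, inner_add_right]
    ring
  rw [toEuclideanLin_stabMatrix, stabNonlin, inner_sub_right, inner_add_right,
    real_inner_smul_right _ _ (1 / 2), inner_add_right, h2, real_inner_smul_right _ (v + u) κ]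
  simp only [energy]
  nlinarith [sq_nonneg ‖v - u‖]

/-- An exponential Runge-Kutta method whose differentiation matrix is positive semidefinite on the
negative axis preserves the energy dissipation law at all stages. -/
theorem preservesEnergyLawAtAllStages_of_diffMatrix_nonneg
    {A : ℝ → Matrix (Fin (s + 1)) (Fin (s + 1)) ℝ}
    (hlow : ∀ z < 0, ∀ i j, i < j → A z i j = 0) (hdet : ∀ z < 0, IsUnit (A z).det)
    (hpos : ∀ z < 0, ∀ y : Fin (s + 1) → ℝ, 0 ≤ ∑ k, ∑ l, y k * (diffMatrix A z k l * y l))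
    {L : Matrix ι ι ℝ} (hL : L.PosSemidef) {G g : Grid ι → Grid ι}
    (hG : ∀ v, HasGradientAt (fun w => ∑ i, G w i) (-(g v)) v)
    {ℓ : NNReal} (hℓ : 0 < ℓ) (hg : LipschitzWith ℓ g) {κ : ℝ} (hκ : 2 * (ℓ : ℝ) ≤ κ) :
    PreservesEnergyLawAtAllStages A L G g κ := by
  intro τ u U hτ hU n
  obtain ⟨h0, hstep, hlast⟩ := hU n
  have hκ0 : 0 < κ := by
    have : (0 : ℝ) < ℓ := hℓ
    linarith
  have hstages : ∀ j : Fin (s + 1), energy L G (U n j.succ) - energy L G (U n 0)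
        ≤ -(1 / τ n) * dissipationForm A L κ (τ n) (U n) j ∧
      -(1 / τ n) * dissipationForm A L κ (τ n) (U n) j ≤ 0 := by
    intro j
    constructor
    · have hform : -(1 / τ n) * dissipationForm A L κ (τ n) (U n) j =
          ∑ k ∈ Iic j, -inner ℝ (U n k.succ - U n k.castSucc)
            (stabNonlin g κ (U n k.castSucc) -
              (1 / 2 : ℝ) • (stabMatrix L κ).toEuclideanLin (U n k.succ + U n k.castSucc)) := by
        rw [dissipationForm, Finset.mul_sum]
        refine Finset.sum_congr rfl fun k hk => ?_
        rw [← inner_sum, sum_matFun_diffMatrix hlow hdet hL hκ0 (hτ n) hstep (Finset.mem_Iic.1 hk),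
          real_inner_smul_right, ← mul_assoc, neg_mul, one_div_mul_cancel (hτ n).ne', neg_one_mul]
      rw [hform, ← Fin.sum_Iic_sub j fun i => energy L G (U n i)]
      exact Finset.sum_le_sum fun k _ => energy_sub_le hL.isHermitian hG hg hκ _ _
    · have := dissipationForm_nonneg hpos hL hκ0 (hτ n) (U n) j
      have := mul_nonneg (one_div_pos.2 (hτ n)).le this
      linarith
  refine ⟨hstages, ?_⟩
  have h := hstages (Fin.last s)
  rw [Fin.succ_last] at h
  rw [hlast, ← h0]
  linarith [h.1, h.2]

end EnergyLaw

/-! ### Diagonal dominance for the two Heun schemes. -/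

section Heun

/-- A quadratic form in three variables with nonnegative coefficients is nonnegative if it is
weakly diagonally dominant. -/
lemma quadForm_nonneg_of_dominant {p q r a b c : ℝ} (ha : 0 ≤ a) (hb : 0 ≤ b) (hc : 0 ≤ c)
    (hp : a + b ≤ 2 * p) (hq : a + c ≤ 2 * q) (hr : b + c ≤ 2 * r) (x y w : ℝ) :
    0 ≤ p * x ^ 2 + q * y ^ 2 + r * w ^ 2 + a * (x * y) + b * (x * w) + c * (y * w) := by
  -- Twice the form is a(x+y)² + b(x+w)² + c(y+w)² plus squares weighted by the dominance gaps.
  nlinarith [mul_nonneg ha (sq_nonneg (x + y)), mul_nonneg hb (sq_nonneg (x + w)),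
    mul_nonneg hc (sq_nonneg (y + w)), mul_nonneg (sub_nonneg.2 hp) (sq_nonneg x),
    mul_nonneg (sub_nonneg.2 hq) (sq_nonneg y), mul_nonneg (sub_nonneg.2 hr) (sq_nonneg w)]

lemma inv_heunPattern {a b c d : ℝ} (ha : a ≠ 0) (hb : b ≠ 0) (hd : d ≠ 0) :
    (!![a, 0, 0; 0, b, 0; c, 0, d] : Matrix (Fin 3) (Fin 3) ℝ)⁻¹ =
      !![1 / a, 0, 0; 0, 1 / b, 0; -c / (a * d), 0, 1 / d] := by
  refine Matrix.inv_eq_right_inv ?_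
  ext i j
  fin_cases i <;> fin_cases j <;> simp [Matrix.mul_apply, Fin.sum_univ_three, ha, hb, hd]
  field_simp
  ring

/-- The energy law for three-stage methods with Heun's sparsity pattern, in terms of the entries
of the differentiation matrix. -/
lemma preservesEnergyLawAtAllStages_heunPattern {A : ℝ → Matrix (Fin 3) (Fin 3) ℝ}
    {a b c d : ℝ → ℝ} (hA : ∀ z, A z = !![a z, 0, 0; 0, b z, 0; c z, 0, d z])
    (ha : ∀ z < 0, a z ≠ 0) (hb : ∀ z < 0, b z ≠ 0) (hd : ∀ z < 0, d z ≠ 0)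
    (h21 : ∀ z < 0, 0 ≤ 1 / b z + z)
    (h31 : ∀ z < 0, 0 ≤ 1 / d z - c z / (a z * d z) + z)
    (h32 : ∀ z < 0, 0 ≤ 1 / d z + z)
    (h1 : ∀ z < 0, (1 / b z + z) + (1 / d z - c z / (a z * d z) + z) ≤ 2 * (1 / a z) + z)
    (h2 : ∀ z < 0, (1 / b z + z) + (1 / d z + z) ≤ 2 * (1 / b z) + z)
    (h3 : ∀ z < 0, (1 / d z - c z / (a z * d z) + z) + (1 / d z + z) ≤ 2 * (1 / d z) + z)
    {ι : Type*} [Fintype ι] [DecidableEq ι]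
    {L : Matrix ι ι ℝ} (hL : L.PosSemidef) {G g : Grid ι → Grid ι}
    (hG : ∀ v, HasGradientAt (fun w => ∑ i, G w i) (-(g v)) v)
    {ℓ : NNReal} (hℓ : 0 < ℓ) (hg : LipschitzWith ℓ g) {κ : ℝ} (hκ : 2 * (ℓ : ℝ) ≤ κ) :
    PreservesEnergyLawAtAllStages A L G g κ := by
  refine preservesEnergyLawAtAllStages_of_diffMatrix_nonneg ?_ ?_ ?_ hL hG hℓ hg hκ
  · intro z _ i j hij
    rw [hA]
    fin_cases i <;> fin_cases j <;> simp_all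
  · intro z hz
    rw [hA, det_fin_three]
    simp [ha z hz, hb z hz, hd z hz]
  · intro z hz y
    have h := quadForm_nonneg_of_dominant (h21 z hz) (h31 z hz) (h32 z hz)
      (p := 1 / a z + z / 2) (q := 1 / b z + z / 2) (r := 1 / d z + z / 2)
      (by linarith [h1 z hz]) (by linarith [h2 z hz]) (by linarith [h3 z hz]) (y 0) (y 1) (y 2)
    refine h.trans_eq ?_
    simp only [diffMatrix, hA, inv_heunPattern (ha z hz) (hb z hz) (hd z hz)]
    have hE : lowerOnes (2 + 1) = !![1, 0, 0; 1, 1, 0; 1, 1, 1] := by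
      ext i j
      fin_cases i <;> fin_cases j <;> simp [lowerOnes]
    simp [Fin.sum_univ_three, hE]
    ring

lemma exp_two_mul_div_three (z : ℝ) : Real.exp (2 * z / 3) = Real.exp (z / 3) ^ 2 := by
  rw [← Real.exp_nat_mul]
  congr 1
  push_cast
  ring

lemma heunTIF3_preservesEnergyLaw {ι : Type*} [Fintype ι] [DecidableEq ι]
    {L : Matrix ι ι ℝ} (hL : L.PosSemidef) {G g : Grid ι → Grid ι}
    (hG : ∀ v, HasGradientAt (fun w => ∑ i, G w i) (-(g v)) v)
    {ℓ : NNReal} (hℓ : 0 < ℓ) (hg : LipschitzWith ℓ g) {κ : ℝ} (hκ : 2 * (ℓ : ℝ) ≤ κ) :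
    PreservesEnergyLawAtAllStages heunTIF3 L G g κ := by
  have hx := exp_two_mul_div_three
  have hx1 : ∀ z : ℝ, z < 0 → Real.exp (z / 3) < 1 := fun z hz => Real.exp_lt_one_iff.2 (by linarith)
  have hΔ : ∀ z : ℝ, z < 0 → 0 < Real.exp (2 * z / 3) * (4 - z) - 3 * z := fun z hz => by
    have := mul_pos (Real.exp_pos (2 * z / 3)) (show 0 < 4 - z by linarith)
    linarith
  have hb : ∀ z : ℝ, z < 0 → 0 < 3 * Real.exp (z / 3) - 2 * z := fun z hz => by
    linarith [Real.exp_pos (z / 3)]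
  -- In the corner entry of `D` all terms linear in z cancel.
  have e31 : ∀ z : ℝ, z < 0 →
      1 / (3 / (Real.exp (2 * z / 3) * (4 - z) - 3 * z)) -
        Real.exp (2 * z / 3) / (Real.exp (2 * z / 3) * (4 - z) - 3 * z) /
          (1 / (3 - z) * (3 / (Real.exp (2 * z / 3) * (4 - z) - 3 * z))) + z =
      Real.exp (2 * z / 3) / 3 := fun z hz => by
    have h1 := (hΔ z hz).ne'
    have h2 : 3 - z ≠ 0 := by linarith
    field_simp
    ring
  refine preservesEnergyLawAtAllStages_heunPattern
    (a := fun z => 1 / (3 - z)) (b := fun z => 2 / (3 * Real.exp (z / 3) - 2 * z))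
    (c := fun z => Real.exp (2 * z / 3) / (Real.exp (2 * z / 3) * (4 - z) - 3 * z))
    (d := fun z => 3 / (Real.exp (2 * z / 3) * (4 - z) - 3 * z))
    (fun z => rfl) (fun z hz => one_div_ne_zero (by linarith))
    (fun z hz => div_ne_zero two_ne_zero (hb z hz).ne')
    (fun z hz => div_ne_zero three_ne_zero (hΔ z hz).ne') ?_ ?_ ?_ ?_ ?_ ?_
    hL hG hℓ hg hκ
  all_goals
    intro z hz
    have hx0 := Real.exp_pos (z / 3)
    have hx1' := hx1 z hz
    have hxx : Real.exp (z / 3) ^ 2 ≤ Real.exp (z / 3) := by nlinarith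
    have hxz : 0 ≤ (1 - Real.exp (z / 3) ^ 2) * -z :=
      mul_nonneg (by linarith) (by linarith)
    have hxz' : 0 ≤ Real.exp (z / 3) ^ 2 * -z := mul_nonneg (sq_nonneg _) (by linarith)
    try simp only [e31 z hz]
    simp only [hx, one_div_div]
    nlinarith [sq_nonneg (Real.exp (z / 3))]

lemma heunNIF3_preservesEnergyLaw {ι : Type*} [Fintype ι] [DecidableEq ι]
    {L : Matrix ι ι ℝ} (hL : L.PosSemidef) {G g : Grid ι → Grid ι}
    (hG : ∀ v, HasGradientAt (fun w => ∑ i, G w i) (-(g v)) v)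
    {ℓ : NNReal} (hℓ : 0 < ℓ) (hg : LipschitzWith ℓ g) {κ : ℝ} (hκ : 2 * (ℓ : ℝ) ≤ κ) :
    PreservesEnergyLawAtAllStages heunNIF3 L G g κ := by
  have hx2 := exp_two_mul_div_three
  have hx3 : ∀ z : ℝ, Real.exp z = Real.exp (z / 3) ^ 3 := fun z => by
    rw [← Real.exp_nat_mul]
    congr 1
    push_cast
    ring
  have hx1 : ∀ z : ℝ, z < 0 → Real.exp (z / 3) < 1 := fun z hz => Real.exp_lt_one_iff.2 (by linarith)
  -- This is 1 + t ≤ e^t at t = -z/3, the only estimate beyond 0 < x < 1 that is needed.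
  have htan : ∀ z : ℝ, Real.exp (z / 3) * (1 - z / 3) ≤ 1 := fun z => by
    have h := Real.add_one_le_exp (-(z / 3))
    have h2 := mul_le_mul_of_nonneg_left h (Real.exp_pos (z / 3)).le
    rw [← Real.exp_add, add_neg_cancel, Real.exp_zero] at h2
    linarith
  have hp : ∀ z : ℝ, z < 0 → Real.exp (z / 3) ^ 3 * (1 - z / 4) ≤ Real.exp (z / 3) ^ 2 :=
    fun z hz => by
      have h := mul_le_mul_of_nonneg_left (htan z) (sq_nonneg (Real.exp (z / 3)))
      have h0 := mul_nonneg (pow_pos (Real.exp_pos (z / 3)) 3).le (show 0 ≤ -z by linarith)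
      linarith
  have hd : ∀ z : ℝ, z < 0 → 0 < (Real.exp z - 1) / z - Real.exp z / 4 := fun z hz => by
    have h1 := hp z hz
    have h2 : Real.exp (z / 3) ^ 2 < 1 := pow_lt_one₀ (Real.exp_pos _).le (hx1 z hz) two_ne_zero
    rw [← hx3] at h1
    rw [sub_pos, lt_div_iff_of_neg hz]
    linarith
  -- the reciprocals of the diagonal entries, and the entry of the differentiation matrix in the
  -- lower left corner
  have key : ∀ z : ℝ, z < 0 → ∃ x P B : ℝ, 0 < x ∧ x < 1 ∧ 0 < P ∧ P ≤ B ∧ z = -((1 - x ^ 2) * B) ∧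
      0 ≤ P + z ∧
      1 / ((Real.exp (z / 3) - 1) / z) = (1 + x) * B ∧
      1 / ((Real.exp (2 * z / 3) - 1) / z) = B ∧
      1 / ((Real.exp z - 1) / z - Real.exp z / 4) = P ∧
      ∃ e, 0 ≤ e ∧ e ≤ x ^ 3 * P ∧
        1 / ((Real.exp z - 1) / z - Real.exp z / 4) - Real.exp z / 4 /
          ((Real.exp (z / 3) - 1) / z * ((Real.exp z - 1) / z - Real.exp z / 4)) + z = e := by
    intro z hz
    have hx0 := Real.exp_pos (z / 3)
    have hx1' := hx1 z hz
    have hp' := hp z hz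
    have hd' := hd z hz
    have ht := htan z
    rw [hx2]
    rw [hx3 z] at hd' ⊢
    set x := Real.exp (z / 3)
    have hz0 : z ≠ 0 := hz.ne
    have hx2' : 0 < 1 - x ^ 2 := by nlinarith
    have hx3' := pow_pos hx0 3
    have hq : 0 < 1 - x ^ 3 * (1 - z / 4) := by linarith
    have hdq : (x ^ 3 - 1) / z - x ^ 3 / 4 = (1 - x ^ 3 * (1 - z / 4)) / -z := by
      field_simp
      ring
    have hx1n : x - 1 ≠ 0 := by linarith
    have hx1n' : 1 - x ≠ 0 := by linarith
    have hP : 0 < -z / (1 - x ^ 3 * (1 - z / 4)) := div_pos (by linarith) hq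
    have hβ : 0 ≤ 1 + z * x / (4 * (1 - x)) := by
      rw [← sub_neg_eq_add, sub_nonneg, ← neg_div, div_le_one (by linarith)]
      linarith
    have hβ' : 1 + z * x / (4 * (1 - x)) ≤ 1 := by
      have : z * x / (4 * (1 - x)) ≤ 0 :=
        div_nonpos_of_nonpos_of_nonneg (by nlinarith) (by linarith)
      linarith
    -- P and B are the reciprocals of the third and second diagonal entries of A. The tangent bound
    -- gives x³(1 - z/4) ≤ x², hence P ≤ B, and puts the last factor of the corner entry in [0, 1].
    refine ⟨x, -z / (1 - x ^ 3 * (1 - z / 4)), -z / (1 - x ^ 2), hx0, hx1', hP, ?_, ?_, ?_, ?_, ?_,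
      ?_, x ^ 3 * (-z / (1 - x ^ 3 * (1 - z / 4))) * (1 + z * x / (4 * (1 - x))), ?_, ?_, ?_⟩
    · exact div_le_div_of_nonneg_left (by linarith) hx2' (by linarith)
    · field_simp
    -- Clearing the denominator, P + z = x³(1 - z/4)P.
    · have hPq := div_mul_cancel₀ (-z) hq.ne'
      have := mul_nonneg (mul_nonneg hx3'.le (show 0 ≤ 1 - z / 4 by linarith)) hP.le
      linarith
    · rw [one_div_div, div_eq_iff hx1n]
      field_simp
      ring
    · rw [one_div_div, ← neg_div_neg_eq, neg_sub]
    · rw [hdq, one_div_div]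
    · exact mul_nonneg (mul_nonneg hx3'.le hP.le) hβ
    · exact mul_le_of_le_one_right (mul_nonneg hx3'.le hP.le) hβ'
    · have hq' := hq.ne'
      rw [hdq]
      generalize hQ : 1 - x ^ 3 * (1 - z / 4) = Q at hq' ⊢
      field_simp
      subst hQ
      ring
  refine preservesEnergyLawAtAllStages_heunPattern
    (a := fun z => (Real.exp (z / 3) - 1) / z) (b := fun z => (Real.exp (2 * z / 3) - 1) / z)
    (c := fun z => Real.exp z / 4) (d := fun z => (Real.exp z - 1) / z - Real.exp z / 4)
    (fun z => rfl) (fun z hz => div_ne_zero (by linarith [hx1 z hz]) hz.ne)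
    (fun z hz => div_ne_zero ?_ hz.ne)
    (fun z hz => (hd z hz).ne') ?_ ?_ ?_ ?_ ?_ ?_ hL hG hℓ hg hκ
  · rw [hx2, sub_ne_zero]
    exact (pow_lt_one₀ (Real.exp_pos _).le (hx1 z hz) two_ne_zero).ne
  all_goals
    intro z hz
    obtain ⟨x, P, B, hx0, hx1', hP, hPB, hzB, hPz, ha, hb, hd', e, he, heP, he'⟩ := key z hz
    simp only [ha, hb, hd']
    have hB := hP.trans_le hPB
    have hxP : x ^ 3 * P ≤ P := mul_le_of_le_one_left hP.le (pow_le_one₀ hx0.le hx1'.le)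
    have hxB := mul_pos hx0 hB
    have hxB2 := mul_pos (pow_pos hx0 2) hB
    -- B + z = x²B, and e ≤ x³P ≤ P ≤ B, so all six conditions are linear in P, B, xB, x²B, z and e.
    linarith

end Heun

end GradientFlow

end

open GradientFlow in
theorem theorem4p1 {ι : Type*} [Fintype ι] [DecidableEq ι]
    (L : Matrix ι ι ℝ) (hL : L.PosSemidef)
    (G g : EuclideanSpace ℝ ι → EuclideanSpace ℝ ι)
    (hG : ∀ v, HasGradientAt (fun w => ∑ i, G w i) (-(g v)) v)
    (ℓ : NNReal) (hℓ : 0 < ℓ) (hg : LipschitzWith ℓ g)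
    (κ : ℝ) (hκ : 2 * (ℓ : ℝ) ≤ κ) :
    PreservesEnergyLawAtAllStages heunTIF3 L G g κ ∧
      PreservesEnergyLawAtAllStages heunNIF3 L G g κ :=
  ⟨heunTIF3_preservesEnergyLaw hL hG hℓ hg hκ, heunNIF3_preservesEnergyLaw hL hG hℓ hg hκ⟩
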